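/- Let $0<\alpha<1$, let $U\subset\mathbb{C}$ be a bounded open set, $X=\partial U$ its boundary, and $b\in X$. Let $\mathrm{lip}\,\alpha$ be the space of bounded functions $f:\mathbb{C}\to\mathbb{C}$ such that $|f(z)-f(w)|\le C|z-w|^\alpha$ for all $z,w$ and some constant $C$, and such that $|f(z)-f(w)|/|z-w|^\alpha\to0$ uniformly as $|z-w|\to0$. Give it the norm $\|f\|_\alpha=\sup_{z\ne w}\frac{|f(z)-f(w)|}{|z-w|^\alpha}+\sup|f|$, and let $\tilde A$ be the set of those $f\in\mathrm{lip}\,\alpha$ that are holomorphic on $U$. Let $\mu$ be a complex Borel measure on $\mathbb{C}\times\mathbb{C}$ whose total variation $|\mu|$ vanishes off $X\times X$ and on the diagonal. Put $$\langle f,L(\mu)\rangle=\int_{X\times X}\frac{f(z)-f(w)}{|z-w|^\alpha}\,d\mu(z,w),\qquad \langle f,g\cdot L(\mu)\rangle=\langle gf,L(\mu)\rangle .$$ The Cauchy transform $\widehat{g\cdot L(\mu)}$ is the distribution $\phi\mapsto-\langle\hat\phi,g\cdot L(\mu)\rangle$ on $C_c^\infty(\mathbb{C})$, where $\hat\phi(z)=\frac1\pi\int_{\mathbb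 C}\frac{\phi(\zeta)}{z-\zeta}\,d\mathcal{L}^2(\zeta)$. Its value at a point $a$ is understood as $$\widehat{g\cdot L(\mu)}(a)=\Big\langle\frac1{\pi(a-z)},\,g\cdot L(\mu)\Big\rangle=\frac1\pi\int_{X\times X}\Big(\frac{g(z)}{a-z}-\frac{g(w)}{a-w}\Big)\frac{d\mu(z,w)}{|z-w|^\alpha},$$ whenever the integrand is defined $|\mu|$-almost everywhere (that is, $|\mu|$ has no mass on $\{z=a\}\cup\{w=a\}$) and is integrable. Then there exist a constant $K>0$ and a Borel set $E\subset\mathbb{C}$ having full area density at $b$, i.e. $\lim_{r\downarrow0}\frac{\mathcal{L}^2(E\cap\{z:|z-b|\le r\})}{\pi r^2}=1$, such that for every $g\in\tilde A$ with $g(b)=0$: the function $a\mapsto\widehat{g\cdot L(\mu)}(a)$ (set equal to $0$, say, wherever the integral does not converge) is locally integrable and represents the distribution $\widehat{g\cdot L(\mu)}$; and for every $a\in E$ the integral defining $\widehat{g\cdot L(\mu)}(a)$ converges absolutely and $$|a-b|\cdot\left|\widehat{g\cdot L(\mu)}(a)\right|\le K\,\|g\|_\alpha .$$ -/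

import Mathlib

open MeasureTheory Filter Topology
open scoped ContDiff

noncomputable section

namespace LipCauchy

/-- The global little Lipschitz class `lip α` on the plane: bounded functions `f` satisfying a
Hölder condition of exponent `α`, with `|f z - f w| / |z - w| ^ α → 0` uniformly
as `|z - w| → 0`. -/
def MemLip (α : ℝ) (f : ℂ → ℂ) : Prop :=
  (∃ M : ℝ, ∀ z, ‖f z‖ ≤ M) ∧
  (∃ C : ℝ, ∀ z w, ‖f z - f w‖ ≤ C * ‖z - w‖ ^ α) ∧
  ∀ ε : ℝ, 0 < ε → ∃ δ : ℝ, 0 < δ ∧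
    ∀ z w, ‖z - w‖ < δ → ‖f z - f w‖ ≤ ε * ‖z - w‖ ^ α

/-- The pure seminorm: the least Hölder constant of exponent `α`
(the pairs `z = w` contribute `0`). -/
def lipSeminorm (α : ℝ) (f : ℂ → ℂ) : ℝ :=
  ⨆ p : ℂ × ℂ, ‖f p.1 - f p.2‖ / ‖p.1 - p.2‖ ^ α

/-- The norm of `lip α`: the pure seminorm plus the supremum norm. -/
def lipNorm (α : ℝ) (f : ℂ → ℂ) : ℝ :=
  lipSeminorm α f + ⨆ z : ℂ, ‖f z‖

/-- The algebra of all `f` in `lip α` that are holomorphic on `U`. -/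
def algebraTilde (α : ℝ) (U : Set ℂ) : Set (ℂ → ℂ) :=
  {f | MemLip α f ∧ DifferentiableOn ℂ f U}

/-- The quotient `(f z - f w) / |z - w| ^ α`. -/
def lipQuotient (α : ℝ) (f : ℂ → ℂ) (p : ℂ × ℂ) : ℂ :=
  (f p.1 - f p.2) / ((‖p.1 - p.2‖ ^ α : ℝ) : ℂ)

/-- The functional `L(μ) : f ↦ ∫ (f z - f w) / |z - w| ^ α dμ(z, w)`. -/
def lipFunctional (α : ℝ) (μ : ComplexMeasure (ℂ × ℂ)) (f : ℂ → ℂ) : ℂ :=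
  VectorMeasure.integral μ (lipQuotient α f) (ContinuousLinearMap.mul ℝ ℂ)

/-- The module action `⟨f, g · T⟩ = ⟨g f, T⟩`. -/
def moduleAct (g : ℂ → ℂ) (T : (ℂ → ℂ) → ℂ) (f : ℂ → ℂ) : ℂ :=
  T (fun z => g z * f z)

/-- Test functions on the plane. -/
def IsTestFunction (φ : ℂ → ℂ) : Prop :=
  ContDiff ℝ ∞ φ ∧ HasCompactSupport φ

/-- The Cauchy transform of a test function, its convolution with `1 / (π z)`. -/
def testCauchy (φ : ℂ → ℂ) (z : ℂ) : ℂ :=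
  (1 / (Real.pi : ℂ)) * ∫ ζ : ℂ, φ ζ / (z - ζ)

/-- The Cauchy transform of a compactly supported distribution `T`, as a distribution:
`⟨φ, T^⟩ = -⟨φ^, T⟩`. -/
def distCauchy (T : (ℂ → ℂ) → ℂ) (φ : ℂ → ℂ) : ℂ :=
  -T (testCauchy φ)

/-- The function `z ↦ 1 / (π (a - z))`. -/
def cauchyKernel (a z : ℂ) : ℂ :=
  1 / ((Real.pi : ℂ) * (a - z))

/-- The value at `a` of the Cauchy transform of `T`, namely `⟨1 / (π (a - z)), T⟩`. -/
def cauchyValue (T : (ℂ → ℂ) → ℂ) (a : ℂ) : ℂ :=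
  T (cauchyKernel a)

/-- The integral defining the value at `a` of the Cauchy transform of `g · L(μ)` converges
absolutely: the set where its integrand is undefined is null for the total variation of `μ`,
and the integrand is integrable. -/
def CauchyConverges (α : ℝ) (μ : ComplexMeasure (ℂ × ℂ)) (g : ℂ → ℂ) (a : ℂ) : Prop :=
  μ.variation {p : ℂ × ℂ | p.1 = a ∨ p.2 = a} = 0 ∧
  VectorMeasure.Integrable μ (lipQuotient α (fun z => g z * cauchyKernel a z))

/-- The function `h` is locally integrable and represents the distribution `S`. -/
def Represents (h : ℂ → ℂ) (S : (ℂ → ℂ) → ℂ) : Prop :=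
  LocallyIntegrable h volume ∧
  ∀ φ : ℂ → ℂ, IsTestFunction φ → S φ = ∫ a : ℂ, φ a * h a

/-- The set `E` is Borel and has full area density at `b`. -/
def HasFullAreaDensity (E : Set ℂ) (b : ℂ) : Prop :=
  MeasurableSet E ∧
  Tendsto (fun r : ℝ => volume.real (E ∩ Metric.closedBall b r) / (Real.pi * r ^ 2))
    (𝓝[>] 0) (𝓝 1)

end LipCauchy

end

/-! Write $\rho=|a-b|$, $s=1+\alpha\in(1,2)$, and let $\nu$ be the sum of the two marginals of
$|\mu|$. The numerator of the integrand splits as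
$$\frac{g(z)}{a-z}-\frac{g(w)}{a-w}=\frac{g(z)-g(w)}{a-z}+\frac{g(w)(z-w)}{(a-z)(a-w)}.$$ After
division by $|z-w|^\alpha$, the Hölder bound controls the first term and subadditivity of $t\mapsto
t^{1-\alpha}$ controls the second. With $|g(w)|\le H|w-b|^\alpha$, where $H$ is the Hölder seminorm
of $g$, this gives $\rho\,|\text{integrand}|\le 5H\,(1+\rho^s|a-z|^{-s}+\rho^s|a-w|^{-s})$
(`enorm_mul_enorm_lipQuotient_mul_cauchyKernel_le`). It remains to bound
$\rho^s\int|a-u|^{-s}\,d\nu(u)$.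

An atom of $\nu$ at $b$ contributes exactly its mass. For the rest of $\nu$, the mean of this
potential over the disc of radius $r$ about $b$ tends to $0$ with $r$, by dominated convergence. By
Markov's inequality the set where it is at most $1$ has full density at $b$
(`hasFullAreaDensity_potentialSublevel`). This set is $E$; it depends on $\mu$ and $\alpha$ but not
on $g$.

Since $s<2$, the same kernels are locally integrable in $a$, uniformly in $z$ and $w$, so Fubini
identifies the pointwise values with the distribution (`represents_cauchyValue`). -/

namespace LipCauchy
open scoped ENNReal NNReal

/-! ### Polar decomposition of a complex measure -/

section ComplexMeasure

variable {X : Type*} [MeasurableSpace X]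

lemma isFiniteMeasure_variation (μ : ComplexMeasure X) : IsFiniteMeasure μ.variation := by
  have hle : μ.variation ≤ (ComplexMeasure.re μ).totalVariation +
      (ComplexMeasure.im μ).totalVariation := by
    refine VectorMeasure.variation_le_of_forall_enorm_le fun s _ => ?_
    have h1 := SignedMeasure.enorm_le_totalVariation (ComplexMeasure.re μ) s
    have h2 := SignedMeasure.enorm_le_totalVariation (ComplexMeasure.im μ) s
    have h3 : ‖μ s‖ₑ ≤ ‖(μ s).re‖ₑ + ‖(μ s).im‖ₑ := by
      simp only [← ofReal_norm]
      rw [← ENNReal.ofReal_add (norm_nonneg _) (norm_nonneg _)]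
      exact ENNReal.ofReal_le_ofReal (Complex.norm_le_abs_re_add_abs_im _)
    exact h3.trans (add_le_add h1 h2)
  have h1 : IsFiniteMeasure (ComplexMeasure.re μ).totalVariation := by
    unfold SignedMeasure.totalVariation; infer_instance
  have h2 : IsFiniteMeasure (ComplexMeasure.im μ).totalVariation := by
    unfold SignedMeasure.totalVariation; infer_instance
  exact isFiniteMeasure_of_le _ hle

/-- Radon–Nikodym applied to the real and imaginary parts, both absolutely continuous with respect
to the variation. -/
lemma exists_withDensity_variation (μ : ComplexMeasure X) :
    ∃ h : X → ℂ, StronglyMeasurable h ∧ Integrable h μ.variation ∧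
      μ.variation.withDensityᵥ h = μ := by
  have := isFiniteMeasure_variation μ
  have hac : VectorMeasure.AbsolutelyContinuous μ μ.variation.toENNRealVectorMeasure := by
    refine VectorMeasure.AbsolutelyContinuous.mk fun s hs h0 => ?_
    rw [Measure.toENNRealVectorMeasure_apply_measurable hs] at h0
    have := VectorMeasure.enorm_measure_le_variation μ s
    simpa [h0] using this
  obtain ⟨hr, hi⟩ := (ComplexMeasure.absolutelyContinuous_ennreal_iff μ _).1 hac
  rw [SignedMeasure.absolutelyContinuous_iff_withDensityᵥ_rnDeriv_eq] at hr hi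
  set f := (ComplexMeasure.re μ).rnDeriv μ.variation
  set k := (ComplexMeasure.im μ).rnDeriv μ.variation
  have hf : Integrable f μ.variation := SignedMeasure.integrable_rnDeriv _ _
  have hk : Integrable k μ.variation := SignedMeasure.integrable_rnDeriv _ _
  have hfm : Measurable f := SignedMeasure.measurable_rnDeriv _ _
  have hkm : Measurable k := SignedMeasure.measurable_rnDeriv _ _
  have hint : Integrable (fun x => (f x : ℂ) + (k x : ℂ) * Complex.I) μ.variation :=
    hf.ofReal.add (hk.ofReal.mul_const _)
  refine ⟨fun x => (f x : ℂ) + (k x : ℂ) * Complex.I, ?_, hint, ?_⟩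
  · exact Measurable.stronglyMeasurable (by fun_prop)
  · ext s hs
    rw [withDensityᵥ_apply hint hs, integral_add hf.ofReal.restrict
      (hk.ofReal.mul_const _).restrict, integral_mul_const, integral_complex_ofReal,
      integral_complex_ofReal, ← withDensityᵥ_apply hf hs, ← withDensityᵥ_apply hk hs, hr, hi]
    exact Complex.re_add_im _

/-- The polar representation of a complex measure, in terms of integrals. -/
lemma exists_integral_eq_integral_variation (μ : ComplexMeasure X) :
    ∃ h : X → ℂ, StronglyMeasurable h ∧ (∀ᵐ x ∂μ.variation, ‖h x‖ = 1) ∧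
      ∀ f : X → ℂ, VectorMeasure.integral μ f (ContinuousLinearMap.mul ℝ ℂ) =
        ∫ x, f x * h x ∂μ.variation := by
  have := isFiniteMeasure_variation μ
  obtain ⟨h, hm, hint, hμ⟩ := exists_withDensity_variation μ
  have hone : ∀ᵐ x ∂μ.variation, ‖h x‖ = 1 := by
    -- The variation of a measure with density `h` has density `‖h‖`; here that variation is the
    -- base measure itself, so `‖h‖ = 1` almost everywhere.
    have h1 := Measure.variation_withDensityᵥ hint
    rw [hμ] at h1
    have h2 : μ.variation.withDensity (fun x => ‖h x‖ₑ) = μ.variation.withDensity 1 := by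
      rw [withDensity_one, ← h1]
    rw [withDensity_eq_iff_of_sigmaFinite hm.enorm.aemeasurable (by fun_prop)] at h2
    filter_upwards [h2] with x hx
    have := congrArg ENNReal.toReal hx
    simpa using this
  refine ⟨h, hm, hone, fun f => ?_⟩
  have hmul : ∀ g : X → ℂ, Integrable g μ.variation →
      Integrable (fun x => g x * h x) μ.variation := fun g hg =>
    hg.mul_bdd (c := 1) hm.aestronglyMeasurable (hone.mono fun x hx => hx.le)
  by_cases hf : Integrable f μ.variation
  · refine Integrable.induction (P := fun f => VectorMeasure.integral μ f
      (ContinuousLinearMap.mul ℝ ℂ) = ∫ x, f x * h x ∂μ.variation) ?_ ?_ ?_ ?_ hf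
    · intro c s hs _
      rw [VectorMeasure.integral_indicator hs, VectorMeasure.setIntegral_const]
      have : (fun x => s.indicator (fun _ => c) x * h x) = s.indicator (fun x => c * h x) := by
        ext x; by_cases hx : x ∈ s <;> simp [hx]
      rw [this, integral_indicator hs, integral_const_mul, ← withDensityᵥ_apply hint hs, hμ]
      rfl
    · intro f g _ hf hg h1 h2
      rw [VectorMeasure.integral_add hf hg, h1, h2, ← integral_add (hmul f hf) (hmul g hg)]
      simp [add_mul]
    · refine isClosed_eq VectorMeasure.continuous_integral ?_
      refine continuous_iff_continuousAt.2 fun f => ?_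
      refine tendsto_integral_of_L1 _ (hmul _ (L1.integrable_coeFn f)).aestronglyMeasurable
        (Eventually.of_forall fun g => hmul _ (L1.integrable_coeFn g)) ?_
      -- Multiplication by the unimodular `h` is an isometry of $L^1$, hence continuous.
      have heq : ∀ g : X →₁[μ.variation] ℂ,
          ∫⁻ x, ‖g x * h x - f x * h x‖ₑ ∂μ.variation = edist g f := by
        intro g
        rw [L1.edist_def]
        refine lintegral_congr_ae ?_
        filter_upwards [hone] with x hx
        have hx' : ‖h x‖ₑ = 1 := by rw [← ofReal_norm, hx]; simp
        rw [← sub_mul, enorm_mul, hx', mul_one, edist_eq_enorm_sub]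
      simp_rw [heq]
      exact tendsto_iff_edist_tendsto_0.1 tendsto_id
    · intro f g hfg hf h1
      rw [← VectorMeasure.integral_congr_ae hfg, h1]
      refine integral_congr_ae ?_
      filter_upwards [hfg] with x hx
      rw [hx]
  -- Both integrals take the default value 0: if `f * h` were integrable, multiplying by the
  -- conjugate of `h` would make `f` integrable.
  · rw [VectorMeasure.integral_undef hf, integral_undef]
    intro hfh
    refine hf ?_
    have h3 : Integrable (fun x => f x * h x * (starRingEnd ℂ) (h x)) μ.variation :=
      hfh.mul_bdd (c := 1) (Complex.continuous_conj.comp_stronglyMeasurable hm).aestronglyMeasurable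
        (hone.mono fun x hx => by simp [hx])
    refine h3.congr ?_
    filter_upwards [hone] with x hx
    rw [mul_assoc, Complex.mul_conj, Complex.normSq_eq_norm_sq, hx]
    simp

end ComplexMeasure

/-! ### Riesz kernels on discs -/

section Riesz

variable {s : ℝ}

lemma lintegral_ball_zero_enorm_rpow_neg_lt_top (hs2 : s < 2) :
    ∫⁻ x in Metric.ball (0 : ℂ) 1, ‖x‖ₑ ^ (-s) < ⊤ := by
  have h := integrableOn_ball_of_norm_le_rpow (μ := (volume : Measure ℂ)) (E := ℂ)
    (f := fun x : ℂ => ‖x‖ ^ (-s)) (C := 1) (α := s) (r := 1) (by simp) (by simpa using hs2)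
    (Eventually.of_forall fun x => by
      rw [one_mul, Real.norm_of_nonneg (by positivity)])
    (measurable_norm.pow_const _).aestronglyMeasurable
  refine lt_of_eq_of_lt (lintegral_congr_ae ?_) h.2
  refine ae_restrict_of_ae ?_
  have h0 : ∀ᵐ x : ℂ, x ≠ 0 := by simp [ae_iff]
  filter_upwards [h0] with x hx
  have : 0 < ‖x‖ := norm_pos_iff.2 hx
  rw [← ofReal_norm, ENNReal.ofReal_rpow_of_pos this, ← ofReal_norm (‖x‖ ^ (-s)),
    Real.norm_of_nonneg (by positivity)]

lemma lintegral_ball_zero_enorm_rpow_neg {r : ℝ} (hr : 0 < r) :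
    ∫⁻ x in Metric.ball (0 : ℂ) r, ‖x‖ₑ ^ (-s) =
      ENNReal.ofReal (r ^ (2 - s)) * ∫⁻ x in Metric.ball (0 : ℂ) 1, ‖x‖ₑ ^ (-s) := by
  have hmeas : Measurable fun x : ℂ => ‖x‖ₑ ^ (-s) := by fun_prop
  have hmap := Measure.map_addHaar_smul (volume : Measure ℂ) hr.ne'
  -- The same dilated integral is computed twice: by change of variables (Jacobian $r^2$) and by
  -- homogeneity of the kernel.
  have h1 : ∫⁻ x, (Metric.ball (0 : ℂ) r).indicator (fun x => ‖x‖ₑ ^ (-s)) (r • x) =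
      ENNReal.ofReal |(r ^ 2)⁻¹| * ∫⁻ x in Metric.ball (0 : ℂ) r, ‖x‖ₑ ^ (-s) := by
    rw [← lintegral_map (f := (Metric.ball (0 : ℂ) r).indicator (fun x => ‖x‖ₑ ^ (-s)))
      (hmeas.indicator measurableSet_ball) (measurable_const_smul r), hmap,
      lintegral_smul_measure, lintegral_indicator measurableSet_ball]
    simp
  have h2 : ∫⁻ x, (Metric.ball (0 : ℂ) r).indicator (fun x => ‖x‖ₑ ^ (-s)) (r • x) =
      ENNReal.ofReal (r ^ (-s)) * ∫⁻ x in Metric.ball (0 : ℂ) 1, ‖x‖ₑ ^ (-s) := by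
    rw [← lintegral_const_mul _ hmeas, ← lintegral_indicator measurableSet_ball]
    refine lintegral_congr fun x => ?_
    have hmem : r • x ∈ Metric.ball (0 : ℂ) r ↔ x ∈ Metric.ball (0 : ℂ) 1 := by
      simp only [mem_ball_zero_iff, norm_smul, Real.norm_of_nonneg hr.le]
      constructor <;> intro h <;> nlinarith
    by_cases hx : x ∈ Metric.ball (0 : ℂ) 1
    · rw [Set.indicator_of_mem (hmem.2 hx), Set.indicator_of_mem hx, enorm_smul,
        ENNReal.mul_rpow_of_ne_top (by simp) (by simp), ← ofReal_norm r,
        Real.norm_of_nonneg hr.le, ENNReal.ofReal_rpow_of_pos hr]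
    · rw [Set.indicator_of_notMem (fun h => hx (hmem.1 h)), Set.indicator_of_notMem hx]
  rw [h1] at h2
  have h3 : ENNReal.ofReal (r ^ 2) * ENNReal.ofReal |(r ^ 2)⁻¹| = 1 := by
    rw [← ENNReal.ofReal_mul (by positivity), abs_of_nonneg (by positivity),
      mul_inv_cancel₀ (by positivity), ENNReal.ofReal_one]
  rw [← one_mul (∫⁻ x in Metric.ball (0 : ℂ) r, ‖x‖ₑ ^ (-s)), ← h3, mul_assoc, h2, ← mul_assoc,
    ← ENNReal.ofReal_mul (by positivity), sub_eq_add_neg, Real.rpow_add hr, Real.rpow_two]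

/-- Riesz kernels of order less than two have uniformly bounded averages over discs. -/
lemma exists_lintegral_closedBall_enorm_sub_rpow_neg_le (hs0 : 0 < s) (hs2 : s < 2) :
    ∃ C : ℝ≥0∞, C ≠ ⊤ ∧ ∀ (c u : ℂ) (r : ℝ), 0 < r →
      ∫⁻ a in Metric.closedBall c r, ‖a - u‖ₑ ^ (-s) ≤ C * ENNReal.ofReal (r ^ (2 - s)) := by
  set I := ∫⁻ x in Metric.ball (0 : ℂ) 1, ‖x‖ₑ ^ (-s) with hI
  have hI' : I ≠ ⊤ := (lintegral_ball_zero_enorm_rpow_neg_lt_top hs2).ne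
  -- `I` covers the disc of radius `r` about the pole `u`; outside it the kernel is at most $r^{-s}$
  -- on an area of at most $\pi r^2$.
  refine ⟨I + NNReal.pi, by finiteness, fun c u r hr => ?_⟩
  have h1 : ∫⁻ a in Metric.ball u r, ‖a - u‖ₑ ^ (-s) = I * ENNReal.ofReal (r ^ (2 - s)) := by
    rw [mul_comm, hI, ← lintegral_ball_zero_enorm_rpow_neg hr,
      ← lintegral_indicator measurableSet_ball, ← lintegral_indicator measurableSet_ball,
      ← lintegral_add_right_eq_self _ u]
    refine lintegral_congr fun x => ?_
    simp [Set.indicator]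
  have h2 : ∫⁻ a in Metric.closedBall c r ∩ (Metric.ball u r)ᶜ, ‖a - u‖ₑ ^ (-s) ≤
      NNReal.pi * ENNReal.ofReal (r ^ (2 - s)) := by
    calc ∫⁻ a in Metric.closedBall c r ∩ (Metric.ball u r)ᶜ, ‖a - u‖ₑ ^ (-s)
        ≤ ∫⁻ a in Metric.closedBall c r ∩ (Metric.ball u r)ᶜ, ENNReal.ofReal (r ^ (-s)) := by
          refine setLIntegral_mono measurable_const fun a ha => ?_
          have ha2 : r ≤ ‖a - u‖ := by simpa [dist_eq_norm] using ha.2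
          rw [← ofReal_norm, ENNReal.ofReal_rpow_of_pos (hr.trans_le ha2)]
          exact ENNReal.ofReal_le_ofReal
            (Real.rpow_le_rpow_of_nonpos hr ha2 (by linarith))
      _ ≤ ENNReal.ofReal (r ^ (-s)) * volume (Metric.closedBall c r) := by
          rw [setLIntegral_const]
          gcongr
          exact Set.inter_subset_left
      _ = NNReal.pi * ENNReal.ofReal (r ^ (2 - s)) := by
          rw [Complex.volume_closedBall, ← ENNReal.ofReal_pow hr.le, ← mul_assoc,
            ← ENNReal.ofReal_mul (by positivity), mul_comm, sub_eq_add_neg, Real.rpow_add hr,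
            Real.rpow_two, mul_comm (r ^ (-s))]
  calc ∫⁻ a in Metric.closedBall c r, ‖a - u‖ₑ ^ (-s)
      ≤ ∫⁻ a in Metric.ball u r ∪ Metric.closedBall c r ∩ (Metric.ball u r)ᶜ,
          ‖a - u‖ₑ ^ (-s) := by
        refine lintegral_mono_set fun a ha => ?_
        by_cases h : a ∈ Metric.ball u r
        · exact Or.inl h
        · exact Or.inr ⟨ha, h⟩
    _ ≤ _ := lintegral_union_le _ _ _
    _ ≤ (I + NNReal.pi) * ENNReal.ofReal (r ^ (2 - s)) := by
        rw [add_mul]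
        exact add_le_add h1.le h2

end Riesz

/-! ### Pointwise estimates of the integrand -/

section Pointwise

variable {α : ℝ}

/-- Both factors are bounded through the larger base. This separates mixed products in `z` and `w`,
so that only the marginals of the measure matter. -/
lemma rpow_mul_rpow_le_add {x y a b : ℝ} (hx : 0 < x) (hy : 0 < y) (ha : 0 ≤ a) (hb : 0 ≤ b) :
    x ^ a * y ^ b ≤ x ^ (a + b) + y ^ (a + b) := by
  rcases le_total x y with h | h
  · calc x ^ a * y ^ b ≤ y ^ a * y ^ b := by gcongr
      _ = y ^ (a + b) := (Real.rpow_add hy _ _).symm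
      _ ≤ _ := le_add_of_nonneg_left (by positivity)
  · calc x ^ a * y ^ b ≤ x ^ a * x ^ b := by gcongr
      _ = x ^ (a + b) := (Real.rpow_add hx _ _).symm
      _ ≤ _ := le_add_of_nonneg_right (by positivity)

lemma le_one_add_rpow {x s : ℝ} (hx : 0 < x) (hs : 1 ≤ s) : x ≤ 1 + x ^ s := by
  rcases le_total x 1 with h | h
  · have : 0 < x ^ s := by positivity
    linarith
  · linarith [Real.self_le_rpow_of_one_le h hs]

lemma norm_lipQuotient_mul_cauchyKernel_le (hα0 : 0 < α) (hα1 : α < 1) {g : ℂ → ℂ} {H : ℝ}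
    {a z w : ℂ} (hg : ‖g z - g w‖ ≤ H * ‖z - w‖ ^ α) (hH : 0 ≤ H) (hz : a ≠ z) (hw : a ≠ w) :
    ‖lipQuotient α (fun z => g z * cauchyKernel a z) (z, w)‖ ≤
      H * ‖a - z‖⁻¹ + ‖g w‖ * ((‖a - z‖⁻¹) ^ α * ‖a - w‖⁻¹ + ‖a - z‖⁻¹ * (‖a - w‖⁻¹) ^ α) := by
  by_cases hzw : z = w
  · simp only [lipQuotient, hzw, sub_self, zero_div, norm_zero]
    positivity
  have hz' : a - z ≠ 0 := sub_ne_zero.2 hz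
  have hw' : a - w ≠ 0 := sub_ne_zero.2 hw
  have hp : 0 < ‖a - z‖ := norm_pos_iff.2 hz'
  have hq : 0 < ‖a - w‖ := norm_pos_iff.2 hw'
  have hd : 0 < ‖z - w‖ := norm_pos_iff.2 (sub_ne_zero.2 hzw)
  have hpi : (Real.pi : ℂ) ≠ 0 := by exact_mod_cast Real.pi_ne_zero
  have hnum : g z * cauchyKernel a z - g w * cauchyKernel a w =
      (1 / (Real.pi : ℂ)) * ((g z - g w) / (a - z) + g w * (z - w) / ((a - z) * (a - w))) := by
    unfold cauchyKernel
    field_simp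
    ring
  have hnorm : ‖g z * cauchyKernel a z - g w * cauchyKernel a w‖ ≤
      H * ‖z - w‖ ^ α / ‖a - z‖ + ‖g w‖ * ‖z - w‖ / (‖a - z‖ * ‖a - w‖) := by
    rw [hnum, norm_mul]
    have h1 : ‖(1 / (Real.pi : ℂ))‖ ≤ 1 := by
      rw [norm_div, norm_one, Complex.norm_real, Real.norm_of_nonneg Real.pi_pos.le,
        div_le_one Real.pi_pos]
      linarith [Real.pi_gt_three]
    refine (mul_le_of_le_one_left (norm_nonneg _) h1).trans ((norm_add_le _ _).trans ?_)
    rw [norm_div, norm_div, norm_mul, norm_mul]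
    gcongr
  -- Dividing by $|z-w|^\alpha$ leaves $|z-w|^{1-\alpha}$, which is absorbed by the two poles; the
  -- singularity drops from total order 2 to $1+\alpha$.
  have hsub : ‖z - w‖ ^ (1 - α) ≤ ‖a - z‖ ^ (1 - α) + ‖a - w‖ ^ (1 - α) := by
    have htri : ‖z - w‖ ≤ ‖a - z‖ + ‖a - w‖ := by
      have := norm_sub_le (a - w) (a - z)
      rw [sub_sub_sub_cancel_left] at this
      linarith
    exact (Real.rpow_le_rpow hd.le htri (by linarith)).trans
      (Real.rpow_add_le_add_rpow hp.le hq.le (by linarith) (by linarith))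
  have hd1 : ‖z - w‖ = ‖z - w‖ ^ (1 - α) * ‖z - w‖ ^ α := by
    rw [← Real.rpow_add hd]; simp
  have hp1 : ‖a - z‖⁻¹ * ‖a - z‖ ^ (1 - α) = (‖a - z‖⁻¹) ^ α := by
    rw [Real.rpow_sub hp, Real.rpow_one, Real.inv_rpow hp.le]
    field_simp
  have hq1 : ‖a - w‖⁻¹ * ‖a - w‖ ^ (1 - α) = (‖a - w‖⁻¹) ^ α := by
    rw [Real.rpow_sub hq, Real.rpow_one, Real.inv_rpow hq.le]
    field_simp
  have hda : 0 < ‖z - w‖ ^ α := by positivity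
  have hquot : ‖lipQuotient α (fun z => g z * cauchyKernel a z) (z, w)‖ =
      ‖g z * cauchyKernel a z - g w * cauchyKernel a w‖ / ‖z - w‖ ^ α := by
    simp only [lipQuotient]
    rw [norm_div, Complex.norm_real, Real.norm_of_nonneg hda.le]
  rw [hquot, div_le_iff₀ hda]
  refine hnorm.trans ?_
  have key : ‖g w‖ * ‖z - w‖ / (‖a - z‖ * ‖a - w‖) ≤
      ‖g w‖ * ((‖a - z‖⁻¹) ^ α * ‖a - w‖⁻¹ + ‖a - z‖⁻¹ * (‖a - w‖⁻¹) ^ α) * ‖z - w‖ ^ α := by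
    rw [← hp1, ← hq1]
    calc ‖g w‖ * ‖z - w‖ / (‖a - z‖ * ‖a - w‖)
        = ‖g w‖ * (‖a - z‖⁻¹ * ‖a - w‖⁻¹ * ‖z - w‖ ^ (1 - α)) * ‖z - w‖ ^ α := by
          nth_rw 1 [hd1]; field_simp
      _ ≤ ‖g w‖ * (‖a - z‖⁻¹ * ‖a - w‖⁻¹ * (‖a - z‖ ^ (1 - α) + ‖a - w‖ ^ (1 - α))) *
            ‖z - w‖ ^ α := by gcongr
      _ = _ := by ring
  calc _ ≤ H * ‖z - w‖ ^ α / ‖a - z‖ + ‖g w‖ * ((‖a - z‖⁻¹) ^ α * ‖a - w‖⁻¹ +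
        ‖a - z‖⁻¹ * (‖a - w‖⁻¹) ^ α) * ‖z - w‖ ^ α := by gcongr
    _ = _ := by ring

lemma enorm_rpow_neg_eq_ofReal {x : ℂ} (hx : x ≠ 0) (s : ℝ) :
    ‖x‖ₑ ^ (-s) = ENNReal.ofReal (‖x‖⁻¹ ^ s) := by
  have : 0 < ‖x‖ := norm_pos_iff.2 hx
  rw [← ofReal_norm, ENNReal.ofReal_rpow_of_pos this, Real.rpow_neg this.le,
    Real.inv_rpow this.le]

/-- Cruder bound without a zero of `g`, used for local integrability in `a`. -/
lemma enorm_lipQuotient_mul_cauchyKernel_le (hα0 : 0 < α) (hα1 : α < 1) {g : ℂ → ℂ} {H M : ℝ}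
    (hg : ∀ z w, ‖g z - g w‖ ≤ H * ‖z - w‖ ^ α) (hH : 0 ≤ H) (hM : ∀ z, ‖g z‖ ≤ M) (hM0 : 0 < M)
    (a : ℂ) (p : ℂ × ℂ) :
    ‖lipQuotient α (fun z => g z * cauchyKernel a z) p‖ₑ ≤ ENNReal.ofReal (H + 2 * M) *
      (1 + ‖a - p.1‖ₑ ^ (-(1 + α)) + ‖a - p.2‖ₑ ^ (-(1 + α))) := by
  obtain ⟨z, w⟩ := p
  -- A nonzero constant makes the right side infinite when `a` is `z` or `w`, so the bound holds
  -- there too.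
  have hC : ENNReal.ofReal (H + 2 * M) ≠ 0 := by
    simp only [ne_eq, ENNReal.ofReal_eq_zero, not_le]; linarith
  have hs : -(1 + α) < 0 := by linarith
  by_cases hz : a = z
  · simp [hz, ENNReal.zero_rpow_of_neg hs, ENNReal.mul_top hC, -neg_add_rev]
  by_cases hw : a = w
  · simp [hw, ENNReal.zero_rpow_of_neg hs, ENNReal.mul_top hC, -neg_add_rev]
  have hz' := sub_ne_zero.2 hz
  have hw' := sub_ne_zero.2 hw
  have hX : 0 < ‖a - z‖⁻¹ := inv_pos.2 (norm_pos_iff.2 hz')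
  have hY : 0 < ‖a - w‖⁻¹ := inv_pos.2 (norm_pos_iff.2 hw')
  simp only [enorm_rpow_neg_eq_ofReal hz', enorm_rpow_neg_eq_ofReal hw']
  rw [← ENNReal.ofReal_one, ← ENNReal.ofReal_add (by positivity) (by positivity),
    ← ENNReal.ofReal_add (by positivity) (by positivity), ← ENNReal.ofReal_mul (by positivity),
    ← ofReal_norm]
  refine ENNReal.ofReal_le_ofReal
    ((norm_lipQuotient_mul_cauchyKernel_le hα0 hα1 (hg z w) hH hz hw).trans ?_)
  set X := ‖a - z‖⁻¹
  set Y := ‖a - w‖⁻¹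
  have h1 : X ≤ 1 + X ^ (1 + α) := le_one_add_rpow hX (by linarith)
  have h2 := rpow_mul_rpow_le_add hX hY hα0.le zero_le_one
  have h3 := rpow_mul_rpow_le_add hX hY zero_le_one hα0.le
  rw [Real.rpow_one, add_comm α 1] at h2
  rw [Real.rpow_one] at h3
  have hXs : 0 < X ^ (1 + α) := by positivity
  have hYs : 0 < Y ^ (1 + α) := by positivity
  calc H * X + ‖g w‖ * (X ^ α * Y + X * Y ^ α)
      ≤ H * (1 + X ^ (1 + α) + Y ^ (1 + α)) + M * (2 * (1 + X ^ (1 + α) + Y ^ (1 + α))) := by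
        gcongr
        · linarith
        · exact hM w
        · linarith
    _ = _ := by ring

lemma enorm_mul_enorm_lipQuotient_mul_cauchyKernel_le (hα0 : 0 < α) (hα1 : α < 1) {g : ℂ → ℂ}
    {H : ℝ} (hg : ∀ z w, ‖g z - g w‖ ≤ H * ‖z - w‖ ^ α) (hH : 0 ≤ H) {a b : ℂ} (hb : g b = 0)
    (hab : a ≠ b) {p : ℂ × ℂ} (hz : a ≠ p.1) (hw : a ≠ p.2) :
    ‖a - b‖ₑ * ‖lipQuotient α (fun z => g z * cauchyKernel a z) p‖ₑ ≤ ENNReal.ofReal (5 * H) *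
      (1 + ‖a - b‖ₑ ^ (1 + α) * (‖a - p.1‖ₑ ^ (-(1 + α)) + ‖a - p.2‖ₑ ^ (-(1 + α)))) := by
  obtain ⟨z, w⟩ := p
  have hz' := sub_ne_zero.2 hz
  have hw' := sub_ne_zero.2 hw
  have hρ : 0 < ‖a - b‖ := norm_pos_iff.2 (sub_ne_zero.2 hab)
  have hq : 0 < ‖a - w‖ := norm_pos_iff.2 hw'
  have hX : 0 < ‖a - z‖⁻¹ := inv_pos.2 (norm_pos_iff.2 hz')
  have hY : 0 < ‖a - w‖⁻¹ := inv_pos.2 hq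
  simp only [enorm_rpow_neg_eq_ofReal hz', enorm_rpow_neg_eq_ofReal hw']
  rw [← ofReal_norm (a - b), ENNReal.ofReal_rpow_of_pos hρ,
    ← ENNReal.ofReal_add (by positivity) (by positivity), ← ENNReal.ofReal_mul (by positivity),
    ← ENNReal.ofReal_one, ← ENNReal.ofReal_add (by positivity) (by positivity),
    ← ENNReal.ofReal_mul (by positivity), ← ofReal_norm, ← ENNReal.ofReal_mul (by positivity)]
  refine ENNReal.ofReal_le_ofReal ?_
  refine (mul_le_mul_of_nonneg_left
    (norm_lipQuotient_mul_cauchyKernel_le hα0 hα1 (hg z w) hH hz hw) hρ.le).trans ?_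
  -- The zero of `g` at `b` enters here: either a power of the pole at `w` is cancelled or a factor
  -- $\rho^\alpha$ is gained.
  have hgw : ‖g w‖ ≤ H * (‖a - w‖ ^ α + ‖a - b‖ ^ α) := by
    have h1 : ‖g w‖ ≤ H * ‖w - b‖ ^ α := by simpa [hb] using hg w b
    have htri : ‖w - b‖ ≤ ‖a - w‖ + ‖a - b‖ := by
      have := norm_sub_le (a - b) (a - w)
      rw [sub_sub_sub_cancel_left] at this
      linarith
    refine h1.trans (mul_le_mul_of_nonneg_left ?_ hH)
    exact (Real.rpow_le_rpow (norm_nonneg _) htri hα0.le).trans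
      (Real.rpow_add_le_add_rpow hq.le hρ.le hα0.le hα1.le)
  set X := ‖a - z‖⁻¹
  set Y := ‖a - w‖⁻¹
  have hqY : ‖a - w‖ = Y⁻¹ := (inv_inv _).symm
  set ρ := ‖a - b‖
  rw [hqY] at hgw
  set x := ρ * X with hx
  set y := ρ * Y with hy
  have hx0 : 0 < x := by positivity
  have hy0 : 0 < y := by positivity
  have e1 : ρ ^ (1 + α) * (X ^ (1 + α) + Y ^ (1 + α)) = x ^ (1 + α) + y ^ (1 + α) := by
    rw [hx, hy, Real.mul_rpow hρ.le hX.le, Real.mul_rpow hρ.le hY.le]; ring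
  -- In the scale-free variables `x`, `y` every term has degree 1 or $1+\alpha$. Degree 1 is
  -- dominated by $1+t^{1+\alpha}$; adding up gives at most $4+5x^{1+\alpha}+3y^{1+\alpha}$, whence
  -- the 5.
  have e2 : ρ * ((Y⁻¹ ^ α + ρ ^ α) * (X ^ α * Y + X * Y ^ α)) =
      x ^ α * y ^ (1 - α) + x + x ^ α * y + x * y ^ α := by
    rw [hx, hy, Real.mul_rpow hρ.le hX.le, Real.mul_rpow hρ.le hY.le,
      Real.mul_rpow hρ.le hY.le, Real.rpow_sub hρ, Real.rpow_sub hY, Real.rpow_one,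
      Real.rpow_one, Real.inv_rpow hY.le]
    field_simp
    ring
  have h1 : x ≤ 1 + x ^ (1 + α) := le_one_add_rpow hx0 (by linarith)
  have h1' : y ≤ 1 + y ^ (1 + α) := le_one_add_rpow hy0 (by linarith)
  have h2 := rpow_mul_rpow_le_add hx0 hy0 hα0.le zero_le_one
  have h3 := rpow_mul_rpow_le_add hx0 hy0 zero_le_one hα0.le
  have h4 := rpow_mul_rpow_le_add hx0 hy0 hα0.le (show 0 ≤ 1 - α by linarith)
  rw [Real.rpow_one, add_comm α 1] at h2
  rw [Real.rpow_one] at h3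
  rw [add_sub_cancel, Real.rpow_one, Real.rpow_one] at h4
  have hxs : 0 < x ^ (1 + α) := by positivity
  have hys : 0 < y ^ (1 + α) := by positivity
  rw [e1]
  calc ρ * (H * X + ‖g w‖ * (X ^ α * Y + X * Y ^ α))
      ≤ ρ * (H * X + H * (Y⁻¹ ^ α + ρ ^ α) * (X ^ α * Y + X * Y ^ α)) := by gcongr
    _ = H * (x + ρ * ((Y⁻¹ ^ α + ρ ^ α) * (X ^ α * Y + X * Y ^ α))) := by rw [hx]; ring
    _ ≤ H * (5 * (1 + (x ^ (1 + α) + y ^ (1 + α)))) := by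
        rw [e2]
        gcongr
        linarith
    _ = _ := by ring

end Pointwise

/-! ### Full density of sublevel sets of Riesz potentials -/

section Density

variable {s : ℝ}

lemma measurable_lintegral_enorm_sub_rpow_neg (ν : Measure ℂ) [SFinite ν] (s : ℝ) :
    Measurable fun a : ℂ => ∫⁻ u, ‖a - u‖ₑ ^ (-s) ∂ν :=
  Measurable.lintegral_prod_right' (f := fun p : ℂ × ℂ => ‖p.1 - p.2‖ₑ ^ (-s)) (by fun_prop)

lemma tendsto_lintegral_average_enorm_sub_rpow_neg (hs0 : 0 < s) (hs2 : s < 2) (ν : Measure ℂ)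
    [IsFiniteMeasure ν] {b : ℂ} (hν : ν {b} = 0) :
    Tendsto (fun r : ℝ => ∫⁻ u, (ENNReal.ofReal (r ^ (s - 2)) *
      ∫⁻ a in Metric.closedBall b r, ‖a - u‖ₑ ^ (-s)) ∂ν) (𝓝[>] 0) (𝓝 0) := by
  obtain ⟨C, hC, hCb⟩ := exists_lintegral_closedBall_enorm_sub_rpow_neg_le hs0 hs2
  have hmeas : ∀ r : ℝ, Measurable fun u : ℂ => ∫⁻ a in Metric.closedBall b r, ‖a - u‖ₑ ^ (-s) :=
    fun r => Measurable.lintegral_prod_right' (f := fun p : ℂ × ℂ => ‖p.2 - p.1‖ₑ ^ (-s))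
      (by fun_prop)
  rw [← lintegral_zero (μ := ν)]
  refine tendsto_lintegral_filter_of_dominated_convergence (fun _ => C)
    (Eventually.of_forall fun r => (hmeas r).const_mul _) ?_ ?_ ?_
  · filter_upwards [self_mem_nhdsWithin] with r hr
    have hr : 0 < r := hr
    refine Eventually.of_forall fun u => ?_
    calc ENNReal.ofReal (r ^ (s - 2)) * ∫⁻ a in Metric.closedBall b r, ‖a - u‖ₑ ^ (-s)
        ≤ ENNReal.ofReal (r ^ (s - 2)) * (C * ENNReal.ofReal (r ^ (2 - s))) := by
          gcongr; exact hCb b u r hr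
      _ = C * ENNReal.ofReal (r ^ (s - 2) * r ^ (2 - s)) := by
          rw [ENNReal.ofReal_mul (by positivity)]; ring
      _ = C := by rw [← Real.rpow_add hr]; simp
  · rw [lintegral_const]
    finiteness
  · have hne : ∀ᵐ u ∂ν, u ≠ b := by simpa [ae_iff] using hν
    filter_upwards [hne] with u hu
    have hd : 0 < ‖u - b‖ := norm_pos_iff.2 (sub_ne_zero.2 hu)
    have hlim : Tendsto (fun r : ℝ =>
        ENNReal.ofReal (r ^ s * ((‖u - b‖ / 2) ^ (-s) * Real.pi))) (𝓝[>] 0) (𝓝 0) := by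
      have h1 : Tendsto (fun r : ℝ => r ^ s * ((‖u - b‖ / 2) ^ (-s) * Real.pi)) (𝓝 0) (𝓝 0) := by
        have := ((Real.continuous_rpow_const hs0.le).mul_const
          ((‖u - b‖ / 2) ^ (-s) * Real.pi)).tendsto 0
        simpa [Real.zero_rpow hs0.ne'] using this
      have h2 := (ENNReal.continuous_ofReal.tendsto 0).comp h1
      rw [ENNReal.ofReal_zero] at h2
      exact h2.mono_left nhdsWithin_le_nhds
    refine tendsto_of_tendsto_of_tendsto_of_le_of_le' tendsto_const_nhds hlim
      (Eventually.of_forall fun _ => zero_le) ?_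
    -- Once $r<|u-b|/2$ the disc stays away from the pole, so the normalised average is $O(r^s)$.
    filter_upwards [Ioo_mem_nhdsGT (half_pos hd)] with r hr
    obtain ⟨hr, hr2⟩ := hr
    calc ENNReal.ofReal (r ^ (s - 2)) * ∫⁻ a in Metric.closedBall b r, ‖a - u‖ₑ ^ (-s)
        ≤ ENNReal.ofReal (r ^ (s - 2)) *
          ∫⁻ a in Metric.closedBall b r, ENNReal.ofReal ((‖u - b‖ / 2) ^ (-s)) := by
          refine mul_le_mul_right ?_ _
          refine setLIntegral_mono measurable_const fun a ha => ?_
          have ha' : ‖a - b‖ ≤ r := by simpa [dist_eq_norm] using ha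
          have hau : ‖u - b‖ / 2 ≤ ‖a - u‖ := by
            have := norm_sub_le (a - b) (a - u)
            rw [sub_sub_sub_cancel_left] at this
            linarith
          rw [← ofReal_norm, ENNReal.ofReal_rpow_of_pos ((half_pos hd).trans_le hau)]
          exact ENNReal.ofReal_le_ofReal
            (Real.rpow_le_rpow_of_nonpos (half_pos hd) hau (by linarith))
      _ = ENNReal.ofReal (r ^ s * ((‖u - b‖ / 2) ^ (-s) * Real.pi)) := by
          rw [setLIntegral_const, Complex.volume_closedBall, ← ENNReal.ofReal_pow hr.le]
          have hpi : (NNReal.pi : ℝ≥0∞) = ENNReal.ofReal Real.pi := by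
            rw [← NNReal.coe_real_pi, ENNReal.ofReal_coe_nnreal]
          rw [hpi, ← ENNReal.ofReal_mul (by positivity), ← ENNReal.ofReal_mul (by positivity),
            ← ENNReal.ofReal_mul (by positivity), Real.rpow_sub hr, Real.rpow_two]
          congr 1
          field_simp

/-- The set where the suitably normalised Riesz potential of a finite measure without mass at `b`
is small. -/
def potentialSublevel (s : ℝ) (ν : Measure ℂ) (b : ℂ) : Set ℂ :=
  {a | a ≠ b ∧ ‖a - b‖ₑ ^ s * ∫⁻ u, ‖a - u‖ₑ ^ (-s) ∂ν ≤ 1}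

lemma measurableSet_potentialSublevel (s : ℝ) (ν : Measure ℂ) [SFinite ν] (b : ℂ) :
    MeasurableSet (potentialSublevel s ν b) := by
  have hQ : Measurable fun a : ℂ => ‖a - b‖ₑ ^ s * ∫⁻ u, ‖a - u‖ₑ ^ (-s) ∂ν :=
    Measurable.mul (by fun_prop) (measurable_lintegral_enorm_sub_rpow_neg ν s)
  exact (measurableSet_singleton b).compl.inter (measurableSet_le hQ measurable_const)

/-- Markov's inequality at level 1, then $|a-b|\le r$ on the disc and Tonelli; the excluded centre
is a null set. -/
lemma volume_closedBall_diff_potentialSublevel_le (hs0 : 0 < s) (ν : Measure ℂ)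
    [IsFiniteMeasure ν] (b : ℂ) {r : ℝ} (hr : 0 < r) :
    volume (Metric.closedBall b r \ potentialSublevel s ν b) ≤
      ENNReal.ofReal (r ^ 2) * ∫⁻ u, (ENNReal.ofReal (r ^ (s - 2)) *
        ∫⁻ a in Metric.closedBall b r, ‖a - u‖ₑ ^ (-s)) ∂ν := by
  have hmeas : Measurable fun p : ℂ × ℂ => ‖p.1 - p.2‖ₑ ^ (-s) := by fun_prop
  set Q : ℂ → ℝ≥0∞ := fun a => ‖a - b‖ₑ ^ s * ∫⁻ u, ‖a - u‖ₑ ^ (-s) ∂ν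
  have hsub : Metric.closedBall b r \ potentialSublevel s ν b ⊆
      {b} ∪ {a | 1 ≤ Q a} ∩ Metric.closedBall b r := by
    rintro a ⟨ha, hE⟩
    by_cases hab : a = b
    · exact Or.inl hab
    · refine Or.inr ⟨?_, ha⟩
      have : ¬ Q a ≤ 1 := fun h => hE ⟨hab, h⟩
      exact (not_le.1 this).le
  calc volume (Metric.closedBall b r \ potentialSublevel s ν b)
      ≤ volume ({b} : Set ℂ) + volume ({a | 1 ≤ Q a} ∩ Metric.closedBall b r) :=
        (measure_mono hsub).trans (measure_union_le _ _)
    _ ≤ (volume.restrict (Metric.closedBall b r)) {a | 1 ≤ Q a} := by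
        rw [measure_singleton, zero_add]
        exact Measure.le_restrict_apply _ _
    _ ≤ ∫⁻ a in Metric.closedBall b r, Q a := by
        have hQ : Measurable Q :=
          Measurable.mul (by fun_prop) (measurable_lintegral_enorm_sub_rpow_neg ν s)
        simpa using mul_meas_ge_le_lintegral (μ := volume.restrict (Metric.closedBall b r)) hQ 1
    _ ≤ ∫⁻ a in Metric.closedBall b r, ENNReal.ofReal (r ^ s) * ∫⁻ u, ‖a - u‖ₑ ^ (-s) ∂ν := by
        refine setLIntegral_mono
          ((measurable_lintegral_enorm_sub_rpow_neg ν s).const_mul _) fun a ha => ?_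
        have ha' : ‖a - b‖ ≤ r := by simpa [dist_eq_norm] using ha
        refine mul_le_mul_left ?_ _
        rw [← ofReal_norm, ← ENNReal.ofReal_rpow_of_nonneg hr.le hs0.le]
        exact ENNReal.rpow_le_rpow (ENNReal.ofReal_le_ofReal ha') hs0.le
    _ = ENNReal.ofReal (r ^ s) *
          ∫⁻ u, (∫⁻ a in Metric.closedBall b r, ‖a - u‖ₑ ^ (-s)) ∂ν := by
        rw [lintegral_const_mul _ (measurable_lintegral_enorm_sub_rpow_neg ν s),
          lintegral_lintegral_swap hmeas.aemeasurable]
    _ = _ := by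
        have hm : Measurable fun u : ℂ => ∫⁻ a in Metric.closedBall b r, ‖a - u‖ₑ ^ (-s) :=
          Measurable.lintegral_prod_right' (f := fun p : ℂ × ℂ => ‖p.2 - p.1‖ₑ ^ (-s))
            (by fun_prop)
        rw [lintegral_const_mul _ hm, ← mul_assoc, ← ENNReal.ofReal_mul (by positivity),
          Real.rpow_sub hr, Real.rpow_two]
        congr 2
        field_simp

lemma hasFullAreaDensity_potentialSublevel (hs0 : 0 < s) (hs2 : s < 2) (ν : Measure ℂ)
    [IsFiniteMeasure ν] {b : ℂ} (hν : ν {b} = 0) :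
    HasFullAreaDensity (potentialSublevel s ν b) b := by
  set E := potentialSublevel s ν b
  have hE : MeasurableSet E := measurableSet_potentialSublevel s ν b
  refine ⟨hE, ?_⟩
  have h0 : Tendsto (fun r : ℝ => volume.real (Metric.closedBall b r \ E) / (r ^ 2))
      (𝓝[>] 0) (𝓝 0) := by
    have h1 := tendsto_lintegral_average_enorm_sub_rpow_neg hs0 hs2 ν hν
    have h2 : Tendsto (fun r : ℝ => volume (Metric.closedBall b r \ E) *
        ENNReal.ofReal ((r ^ 2)⁻¹)) (𝓝[>] 0) (𝓝 0) := by
      refine tendsto_of_tendsto_of_tendsto_of_le_of_le' tendsto_const_nhds h1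
        (Eventually.of_forall fun _ => zero_le) ?_
      filter_upwards [self_mem_nhdsWithin] with r hr
      have hr : 0 < r := hr
      refine (mul_le_mul_left
        (volume_closedBall_diff_potentialSublevel_le hs0 ν b hr) _).trans_eq ?_
      rw [mul_right_comm, ← ENNReal.ofReal_mul (by positivity), mul_inv_cancel₀ (by positivity),
        ENNReal.ofReal_one, one_mul]
    have h3 := (ENNReal.tendsto_toReal ENNReal.zero_ne_top).comp h2
    rw [ENNReal.toReal_zero] at h3
    refine h3.congr fun r => ?_
    simp only [Function.comp_apply, ENNReal.toReal_mul]
    rw [ENNReal.toReal_ofReal (by positivity), div_eq_mul_inv, Measure.real]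
  have h4 : Tendsto (fun r : ℝ =>
      1 - volume.real (Metric.closedBall b r \ E) / (r ^ 2) / Real.pi) (𝓝[>] 0) (𝓝 1) := by
    simpa using (h0.div_const Real.pi).const_sub 1
  refine h4.congr' ?_
  filter_upwards [self_mem_nhdsWithin] with r hr
  have hr : 0 < r := hr
  have hvol : volume.real (Metric.closedBall b r) = Real.pi * r ^ 2 := by
    rw [Measure.real, Complex.volume_closedBall, ENNReal.toReal_mul, ENNReal.toReal_pow,
      ENNReal.toReal_ofReal hr.le]
    simp [mul_comm]
  have hadd := measureReal_inter_add_sdiff (μ := (volume : Measure ℂ))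
    (s := Metric.closedBall b r) hE measure_closedBall_lt_top.ne
  rw [Set.inter_comm, hvol] at hadd
  rw [eq_div_iff (by positivity), eq_sub_of_add_eq hadd]
  field_simp

end Density

/-! ### Hölder seminorm and measurability -/

section LittleLipschitz

variable {α : ℝ} {g : ℂ → ℂ}

lemma lipSeminorm_nonneg (α : ℝ) (g : ℂ → ℂ) : 0 ≤ lipSeminorm α g :=
  Real.iSup_nonneg fun _ => by positivity

lemma lipSeminorm_le_lipNorm (α : ℝ) (g : ℂ → ℂ) : lipSeminorm α g ≤ lipNorm α g :=
  le_add_of_nonneg_right (Real.iSup_nonneg fun _ => norm_nonneg _)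

lemma MemLip.norm_sub_le (hα : 0 < α) (hg : MemLip α g) (z w : ℂ) :
    ‖g z - g w‖ ≤ lipSeminorm α g * ‖z - w‖ ^ α := by
  obtain ⟨-, ⟨C, hC⟩, -⟩ := hg
  rcases eq_or_ne z w with rfl | hzw
  · simp [Real.zero_rpow hα.ne']
  have hd : 0 < ‖z - w‖ ^ α := Real.rpow_pos_of_pos (norm_pos_iff.2 (sub_ne_zero.2 hzw)) _
  -- A real supremum over an unbounded family would default to 0, so boundedness must be checked.
  have hbdd : BddAbove (Set.range fun p : ℂ × ℂ => ‖g p.1 - g p.2‖ / ‖p.1 - p.2‖ ^ α) := by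
    refine ⟨|C|, ?_⟩
    rintro _ ⟨p, rfl⟩
    refine div_le_of_le_mul₀ (by positivity) (abs_nonneg _) ((hC _ _).trans ?_)
    gcongr
    exact le_abs_self C
  exact (div_le_iff₀ hd).1 (le_ciSup hbdd (z, w))

lemma MemLip.continuous (hα : 0 < α) (hg : MemLip α g) : Continuous g := by
  refine continuous_iff_continuousAt.2 fun z => ?_
  refine tendsto_iff_norm_sub_tendsto_zero.2 (squeeze_zero (fun _ => norm_nonneg _)
    (fun w => hg.norm_sub_le hα w z) ?_)
  have h1 : Continuous fun w : ℂ => lipSeminorm α g * ‖w - z‖ ^ α :=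
    continuous_const.mul ((continuous_id.sub continuous_const).norm.rpow_const
      fun _ => Or.inr hα.le)
  simpa [Real.zero_rpow hα.ne'] using h1.tendsto z

lemma measurable_lipQuotient_mul_cauchyKernel (hg : Measurable g) :
    Measurable fun q : ℂ × (ℂ × ℂ) =>
      lipQuotient α (fun z => g z * cauchyKernel q.1 z) q.2 := by
  unfold lipQuotient cauchyKernel
  fun_prop

end LittleLipschitz

/-! ### Fubini and the Cauchy kernel -/

section Representation

variable {α : ℝ} {g : ℂ → ℂ}

/-- Tonelli with `a` integrated first: the Riesz bound is uniform in the poles `p.1`, `p.2`, and `m`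
is finite. -/
lemma integrable_lipQuotient_mul_cauchyKernel_prod (hα0 : 0 < α) (hα1 : α < 1) (hg : MemLip α g)
    (m : Measure (ℂ × ℂ)) [IsFiniteMeasure m] (R : ℝ) :
    Integrable (fun q : ℂ × (ℂ × ℂ) => lipQuotient α (fun z => g z * cauchyKernel q.1 z) q.2)
      ((volume.restrict (Metric.closedBall 0 R)).prod m) := by
  have hm := measurable_lipQuotient_mul_cauchyKernel (α := α) (hg.continuous hα0).measurable
  refine ⟨hm.aestronglyMeasurable, ?_⟩
  obtain ⟨M, hM⟩ := hg.1
  have hM' : ∀ z, ‖g z‖ ≤ |M| + 1 := fun z => (hM z).trans (by linarith [le_abs_self M])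
  obtain ⟨C, hC, hCb⟩ := exists_lintegral_closedBall_enorm_sub_rpow_neg_le
    (s := 1 + α) (by linarith) (by linarith)
  set B : Set ℂ := Metric.closedBall 0 R
  set B' : Set ℂ := Metric.closedBall 0 (|R| + 1)
  have hBB : B ⊆ B' := Metric.closedBall_subset_closedBall (by linarith [le_abs_self R])
  have hR : 0 < |R| + 1 := by positivity
  set D := ENNReal.ofReal (lipSeminorm α g + 2 * (|M| + 1))
  set J := C * ENNReal.ofReal ((|R| + 1) ^ (2 - (1 + α)))
  have hvol : volume B' ≠ ⊤ := measure_closedBall_lt_top.ne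
  unfold HasFiniteIntegral
  rw [lintegral_prod_symm _ hm.enorm.aemeasurable]
  calc ∫⁻ p, ∫⁻ a in B, ‖lipQuotient α (fun z => g z * cauchyKernel a z) p‖ₑ ∂volume ∂m
      ≤ ∫⁻ p, D * (volume B' + J + J) ∂m := by
        refine lintegral_mono fun p => ?_
        calc ∫⁻ a in B, ‖lipQuotient α (fun z => g z * cauchyKernel a z) p‖ₑ
            ≤ ∫⁻ a in B', D * (1 + ‖a - p.1‖ₑ ^ (-(1 + α)) + ‖a - p.2‖ₑ ^ (-(1 + α))) :=
              (lintegral_mono_set hBB).trans (lintegral_mono fun a =>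
                enorm_lipQuotient_mul_cauchyKernel_le hα0 hα1 (hg.norm_sub_le hα0)
                  (lipSeminorm_nonneg α g) hM' (by positivity) a p)
          _ ≤ D * (volume B' + J + J) := by
              rw [lintegral_const_mul _ (by fun_prop), lintegral_add_right _ (by fun_prop),
                lintegral_add_right _ (by fun_prop), setLIntegral_one]
              gcongr
              · exact hCb 0 p.1 _ hR
              · exact hCb 0 p.2 _ hR
    _ < ⊤ := by
        rw [lintegral_const]
        finiteness

lemma enorm_cauchyKernel_le (a z : ℂ) : ‖cauchyKernel a z‖ₑ ≤ ‖a - z‖ₑ ^ (-1 : ℝ) := by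
  rcases eq_or_ne a z with rfl | h
  · simp [cauchyKernel]
  rw [enorm_rpow_neg_eq_ofReal (sub_ne_zero.2 h), ← ofReal_norm, Real.rpow_one]
  refine ENNReal.ofReal_le_ofReal ?_
  unfold cauchyKernel
  rw [norm_div, norm_one, norm_mul, Complex.norm_real, Real.norm_of_nonneg Real.pi_pos.le,
    one_div, mul_inv]
  exact mul_le_of_le_one_left (by positivity)
    (inv_le_one_of_one_le₀ (by linarith [Real.pi_gt_three]))

lemma integrableOn_cauchyKernel (z : ℂ) (R : ℝ) :
    IntegrableOn (fun a => cauchyKernel a z) (Metric.closedBall 0 R) := by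
  have hm : Measurable fun a => cauchyKernel a z := by unfold cauchyKernel; fun_prop
  obtain ⟨C, hC, hCb⟩ := exists_lintegral_closedBall_enorm_sub_rpow_neg_le
    (s := 1) one_pos one_lt_two
  refine ⟨hm.aestronglyMeasurable, ?_⟩
  have hBB : Metric.closedBall (0 : ℂ) R ⊆ Metric.closedBall 0 (|R| + 1) :=
    Metric.closedBall_subset_closedBall (by linarith [le_abs_self R])
  calc ∫⁻ a in Metric.closedBall (0 : ℂ) R, ‖cauchyKernel a z‖ₑ
      ≤ ∫⁻ a in Metric.closedBall (0 : ℂ) (|R| + 1), ‖a - z‖ₑ ^ (-1 : ℝ) :=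
        (lintegral_mono_set hBB).trans (lintegral_mono fun a => enorm_cauchyKernel_le a z)
    _ ≤ _ := hCb 0 z _ (by positivity)
    _ < ⊤ := by finiteness

lemma neg_testCauchy (φ : ℂ → ℂ) (z : ℂ) : -testCauchy φ z = ∫ a, φ a * cauchyKernel a z := by
  unfold testCauchy cauchyKernel
  rw [← integral_const_mul, ← integral_neg]
  refine integral_congr_ae (Eventually.of_forall fun a => ?_)
  simp only
  rw [← neg_sub z a, mul_neg, div_neg, mul_neg, one_div_mul_eq_div, mul_one_div, div_div,
    mul_comm (z - a)]

lemma IsTestFunction.exists_closedBall {φ : ℂ → ℂ} (hφ : IsTestFunction φ) :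
    ∃ R : ℝ, ∀ a, a ∉ Metric.closedBall (0 : ℂ) R → φ a = 0 := by
  obtain ⟨R, hR⟩ := hφ.2.isCompact.isBounded.subset_closedBall 0
  exact ⟨R, fun a ha => image_eq_zero_of_notMem_tsupport fun h => ha (hR h)⟩

/-- For fixed `p` the quotient is linear in two values of `testCauchy φ`. The sign in `distCauchy`
turns $1/(z-a)$ into $1/(a-z)$. -/
lemma neg_lipQuotient_mul_testCauchy {φ : ℂ → ℂ} (hφ : IsTestFunction φ) (p : ℂ × ℂ) :
    -lipQuotient α (fun z => g z * testCauchy φ z) p =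
      ∫ a, φ a * lipQuotient α (fun z => g z * cauchyKernel a z) p := by
  obtain ⟨R, hR⟩ := hφ.exists_closedBall
  obtain ⟨M, hM⟩ := hφ.2.exists_bound_of_continuous hφ.1.continuous
  have hint : ∀ z, Integrable fun a => φ a * cauchyKernel a z := by
    intro z
    have h1 : IntegrableOn (fun a => φ a * cauchyKernel a z) (Metric.closedBall 0 R) :=
      (integrableOn_cauchyKernel z R).bdd_mul (c := M)
        hφ.1.continuous.aestronglyMeasurable (Eventually.of_forall hM)
    refine (integrableOn_iff_integrable_of_support_subset fun a ha => ?_).1 h1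
    by_contra h
    exact ha (by simp [hR a h])
  have h1 : -lipQuotient α (fun z => g z * testCauchy φ z) p =
      (g p.1 * -testCauchy φ p.1 - g p.2 * -testCauchy φ p.2) / ((‖p.1 - p.2‖ ^ α : ℝ) : ℂ) := by
    simp only [lipQuotient]
    ring
  rw [h1, neg_testCauchy, neg_testCauchy, ← integral_const_mul, ← integral_const_mul,
    ← integral_sub ((hint _).const_mul _) ((hint _).const_mul _), ← integral_div]
  refine integral_congr_ae (Eventually.of_forall fun a => ?_)
  simp only [lipQuotient]
  ring

end Representation

/-! ### Representation of the distribution and the bound on the density set -/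

section Main

variable {α : ℝ} {g : ℂ → ℂ}

lemma represents_cauchyValue (hα0 : 0 < α) (hα1 : α < 1) (hg : MemLip α g)
    (μ : ComplexMeasure (ℂ × ℂ)) :
    Represents (cauchyValue (moduleAct g (lipFunctional α μ)))
      (distCauchy (moduleAct g (lipFunctional α μ))) := by
  have := isFiniteMeasure_variation μ
  obtain ⟨h, hm, hone, hμ⟩ := exists_integral_eq_integral_variation μ
  set F : ℂ → ℂ × ℂ → ℂ := fun a p => lipQuotient α (fun z => g z * cauchyKernel a z) p
  have hval : cauchyValue (moduleAct g (lipFunctional α μ)) =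
      fun a => ∫ p, F a p * h p ∂μ.variation := funext fun a => hμ _
  have hFh : ∀ R : ℝ, Integrable (fun q : ℂ × (ℂ × ℂ) => F q.1 q.2 * h q.2)
      ((volume.restrict (Metric.closedBall 0 R)).prod μ.variation) := fun R =>
    (integrable_lipQuotient_mul_cauchyKernel_prod hα0 hα1 hg μ.variation R).mul_bdd (c := 1)
      (hm.comp_measurable measurable_snd).aestronglyMeasurable
      ((Measure.quasiMeasurePreserving_snd.ae hone).mono fun q hq => hq.le)
  refine ⟨?_, fun φ hφ => ?_⟩
  · rw [hval, locallyIntegrable_iff]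
    intro k hk
    obtain ⟨R, hR⟩ := hk.isBounded.subset_closedBall 0
    exact IntegrableOn.mono_set (hFh R).integral_prod_left hR
  · obtain ⟨R, hR⟩ := hφ.exists_closedBall
    obtain ⟨M, hM⟩ := hφ.2.exists_bound_of_continuous hφ.1.continuous
    have hdist : distCauchy (moduleAct g (lipFunctional α μ)) φ =
        -∫ p, lipQuotient α (fun z => g z * testCauchy φ z) p * h p ∂μ.variation :=
      congrArg Neg.neg (hμ _)
    have hint : Integrable (fun q : ℂ × (ℂ × ℂ) => φ q.1 * (F q.1 q.2 * h q.2))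
        ((volume.restrict (Metric.closedBall 0 R)).prod μ.variation) :=
      (hFh R).bdd_mul (c := M) (hφ.1.continuous.comp continuous_fst).aestronglyMeasurable
        (Eventually.of_forall fun q => hM q.1)
    have hcut : ∀ k : ℂ → ℂ, ∫ a, φ a * k a = ∫ a in Metric.closedBall 0 R, φ a * k a := fun k =>
      (setIntegral_eq_integral_of_forall_compl_eq_zero fun a ha => by rw [hR a ha, zero_mul]).symm
    calc distCauchy (moduleAct g (lipFunctional α μ)) φ
        = ∫ p, (∫ a, φ a * F a p) * h p ∂μ.variation := by
          rw [hdist, ← integral_neg]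
          refine integral_congr_ae (Eventually.of_forall fun p => ?_)
          simp only [F]
          rw [← neg_lipQuotient_mul_testCauchy hφ, neg_mul]
      _ = ∫ p, (∫ a in Metric.closedBall 0 R, φ a * (F a p * h p)) ∂μ.variation := by
          refine integral_congr_ae (Eventually.of_forall fun p => ?_)
          simp only
          rw [hcut (fun a => F a p), ← integral_mul_const]
          simp only [mul_assoc]
      _ = ∫ a in Metric.closedBall 0 R, (∫ p, φ a * (F a p * h p) ∂μ.variation) :=
          (integral_integral_swap hint).symm
      _ = ∫ a, φ a * cauchyValue (moduleAct g (lipFunctional α μ)) a := by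
          rw [hcut, hval]
          simp only [integral_const_mul]

/-- The sum of the two marginals of a measure on a product `X × X`. -/
noncomputable def marginalSum {X : Type*} [MeasurableSpace X] (m : Measure (X × X)) : Measure X :=
  m.map Prod.fst + m.map Prod.snd

instance {X : Type*} [MeasurableSpace X] (m : Measure (X × X)) [IsFiniteMeasure m] :
    IsFiniteMeasure (marginalSum m) := by
  unfold marginalSum; infer_instance

lemma lintegral_marginalSum {X : Type*} [MeasurableSpace X] (m : Measure (X × X))
    {f : X → ℝ≥0∞} (hf : Measurable f) :
    ∫⁻ u, f u ∂marginalSum m = ∫⁻ p, (f p.1 + f p.2) ∂m := by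
  rw [marginalSum, lintegral_add_measure, lintegral_map hf measurable_fst,
    lintegral_map hf measurable_snd,
    lintegral_add_left (f := fun p : X × X => f p.1) (hf.comp measurable_fst)]

lemma marginalSum_univ {X : Type*} [MeasurableSpace X] (m : Measure (X × X)) :
    marginalSum m Set.univ = 2 * m Set.univ := by
  rw [marginalSum, Measure.add_apply, Measure.map_apply measurable_fst MeasurableSet.univ,
    Measure.map_apply measurable_snd MeasurableSet.univ, two_mul]
  simp

variable {m : Measure (ℂ × ℂ)} {a b : ℂ} {s : ℝ}

lemma enorm_rpow_mul_lintegral_marginalSum_le (ha : a ∈ potentialSublevel s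
    ((marginalSum m).restrict {b}ᶜ) b) :
    ‖a - b‖ₑ ^ s * ∫⁻ u, ‖a - u‖ₑ ^ (-s) ∂marginalSum m ≤ 2 * m Set.univ + 1 := by
  obtain ⟨hab, ha⟩ := ha
  have hab' : ‖a - b‖ₑ ≠ 0 := enorm_ne_zero.2 (sub_ne_zero.2 hab)
  rw [← lintegral_add_compl _ (measurableSet_singleton b), mul_add]
  refine add_le_add ?_ ha
  -- At $u=b$ the normalised kernel equals 1, so the atom adds its mass, at most the total mass `2 *
  -- m Set.univ`.
  rw [lintegral_singleton, ← mul_assoc, ← ENNReal.rpow_add _ _ hab' (by simp), add_neg_cancel,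
    ENNReal.rpow_zero, one_mul, ← marginalSum_univ]
  exact measure_mono (Set.subset_univ _)

/-- The kernel is infinite at its pole, so a finite potential at `a` rules out marginal mass there.
-/
lemma ae_ne_of_mem_potentialSublevel [IsFiniteMeasure m] (hs : 0 < s)
    (ha : a ∈ potentialSublevel s ((marginalSum m).restrict {b}ᶜ) b) :
    ∀ᵐ p ∂m, a ≠ p.1 ∧ a ≠ p.2 := by
  have h1 := enorm_rpow_mul_lintegral_marginalSum_le ha
  have hab' : ‖a - b‖ₑ ≠ 0 := enorm_ne_zero.2 (sub_ne_zero.2 ha.1)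
  have hpos : ‖a - b‖ₑ ^ s ≠ 0 := (ENNReal.rpow_pos (pos_iff_ne_zero.2 hab') (by simp)).ne'
  have hfin : ∫⁻ u, ‖a - u‖ₑ ^ (-s) ∂marginalSum m ≠ ⊤ := by
    intro htop
    rw [htop, ENNReal.mul_top hpos, top_le_iff] at h1
    exact absurd h1 (by finiteness)
  rw [lintegral_marginalSum m (by fun_prop)] at hfin
  filter_upwards [ae_lt_top (by fun_prop) hfin] with p hp
  have hs' : -s < 0 := by linarith
  constructor <;> intro h <;> simp [← h, ENNReal.zero_rpow_of_neg hs'] at hp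

lemma enorm_mul_lintegral_lipQuotient_le [IsFiniteMeasure m] (hα0 : 0 < α) (hα1 : α < 1)
    (hg : MemLip α g) (hb : g b = 0)
    (ha : a ∈ potentialSublevel (1 + α) ((marginalSum m).restrict {b}ᶜ) b) :
    ‖a - b‖ₑ * ∫⁻ p, ‖lipQuotient α (fun z => g z * cauchyKernel a z) p‖ₑ ∂m ≤
      ENNReal.ofReal (5 * lipSeminorm α g) * (3 * m Set.univ + 1) := by
  have hmeas : Measurable fun p : ℂ × ℂ => lipQuotient α (fun z => g z * cauchyKernel a z) p :=
    (measurable_lipQuotient_mul_cauchyKernel (hg.continuous hα0).measurable).comp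
      (measurable_const.prodMk measurable_id)
  rw [← lintegral_const_mul _ hmeas.enorm]
  calc ∫⁻ p, ‖a - b‖ₑ * ‖lipQuotient α (fun z => g z * cauchyKernel a z) p‖ₑ ∂m
      ≤ ∫⁻ p, ENNReal.ofReal (5 * lipSeminorm α g) * (1 + ‖a - b‖ₑ ^ (1 + α) *
          (‖a - p.1‖ₑ ^ (-(1 + α)) + ‖a - p.2‖ₑ ^ (-(1 + α)))) ∂m := by
        refine lintegral_mono_ae ?_
        filter_upwards [ae_ne_of_mem_potentialSublevel (by linarith) ha] with p hp
        exact enorm_mul_enorm_lipQuotient_mul_cauchyKernel_le hα0 hα1 (hg.norm_sub_le hα0)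
          (lipSeminorm_nonneg α g) hb ha.1 hp.1 hp.2
    _ = ENNReal.ofReal (5 * lipSeminorm α g) * (m Set.univ + ‖a - b‖ₑ ^ (1 + α) *
          ∫⁻ u, ‖a - u‖ₑ ^ (-(1 + α)) ∂marginalSum m) := by
        rw [lintegral_const_mul _ (by fun_prop), lintegral_add_left measurable_const,
          lintegral_const_mul _ (by fun_prop), lintegral_marginalSum m (by fun_prop),
          lintegral_one]
    _ ≤ ENNReal.ofReal (5 * lipSeminorm α g) * (m Set.univ + (2 * m Set.univ + 1)) := by
        gcongr
        exact enorm_rpow_mul_lintegral_marginalSum_le ha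
    _ = _ := by ring

lemma cauchyConverges_of_mem_potentialSublevel {μ : ComplexMeasure (ℂ × ℂ)}
    (hα0 : 0 < α) (hα1 : α < 1) (hg : MemLip α g) (hb : g b = 0)
    (ha : a ∈ potentialSublevel (1 + α) ((marginalSum μ.variation).restrict {b}ᶜ) b) :
    CauchyConverges α μ g a := by
  have := isFiniteMeasure_variation μ
  refine ⟨?_, ?_, ?_⟩
  · rw [← compl_mem_ae_iff]
    filter_upwards [ae_ne_of_mem_potentialSublevel (by linarith) ha] with p hp hp'
    exact hp'.elim (fun h => hp.1 h.symm) fun h => hp.2 h.symm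
  · exact ((measurable_lipQuotient_mul_cauchyKernel (hg.continuous hα0).measurable).comp
      (measurable_const.prodMk measurable_id)).aestronglyMeasurable
  · have h1 := enorm_mul_lintegral_lipQuotient_le hα0 hα1 hg hb ha
    have hab' : ‖a - b‖ₑ ≠ 0 := enorm_ne_zero.2 (sub_ne_zero.2 ha.1)
    -- Since $a\ne b$, an infinite integral would stay infinite after multiplication by $|a-b|$,
    -- against the finite bound.
    refine lt_top_iff_ne_top.2 fun htop => ?_
    rw [htop, ENNReal.mul_top hab', top_le_iff] at h1
    exact absurd h1 (by finiteness)

lemma norm_mul_norm_cauchyValue_le {μ : ComplexMeasure (ℂ × ℂ)}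
    (hα0 : 0 < α) (hα1 : α < 1) (hg : MemLip α g) (hb : g b = 0)
    (ha : a ∈ potentialSublevel (1 + α) ((marginalSum μ.variation).restrict {b}ᶜ) b) :
    ‖a - b‖ * ‖cauchyValue (moduleAct g (lipFunctional α μ)) a‖ ≤
      5 * (3 * μ.variation.real Set.univ + 1) * lipNorm α g := by
  have := isFiniteMeasure_variation μ
  obtain ⟨h, hm, hone, hμ⟩ := exists_integral_eq_integral_variation μ
  have hle : ‖cauchyValue (moduleAct g (lipFunctional α μ)) a‖ₑ ≤
      ∫⁻ p, ‖lipQuotient α (fun z => g z * cauchyKernel a z) p‖ₑ ∂μ.variation := by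
    have hval : cauchyValue (moduleAct g (lipFunctional α μ)) a =
      ∫ p, lipQuotient α (fun z => g z * cauchyKernel a z) p * h p ∂μ.variation := hμ _
    rw [hval]
    refine (enorm_integral_le_lintegral_enorm _).trans_eq (lintegral_congr_ae ?_)
    filter_upwards [hone] with p hp
    rw [enorm_mul, ← ofReal_norm (h p), hp, ENNReal.ofReal_one, mul_one]
  have h1 := (mul_le_mul_right hle ‖a - b‖ₑ).trans
    (enorm_mul_lintegral_lipQuotient_le hα0 hα1 hg hb ha)
  have h2 := ENNReal.toReal_mono (by finiteness) h1
  have hn := lipSeminorm_nonneg α g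
  have h3 : (3 * μ.variation Set.univ + 1).toReal = 3 * μ.variation.real Set.univ + 1 := by
    rw [ENNReal.toReal_add (by finiteness) (by finiteness), ENNReal.toReal_mul]
    simp [Measure.real]
  rw [ENNReal.toReal_mul, ENNReal.toReal_mul, h3, toReal_enorm, toReal_enorm,
    ENNReal.toReal_ofReal (by positivity)] at h2
  calc _ ≤ 5 * lipSeminorm α g * (3 * μ.variation.real Set.univ + 1) := h2
    _ ≤ 5 * lipNorm α g * (3 * μ.variation.real Set.univ + 1) := by
        gcongr
        exact lipSeminorm_le_lipNorm α g
    _ = _ := by ring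

end Main

end LipCauchy

theorem lemma4p6 (α : ℝ) (hα0 : 0 < α) (hα1 : α < 1)
    (U : Set ℂ) (hUo : IsOpen U) (hUb : Bornology.IsBounded U)
    (b : ℂ) (hb : b ∈ frontier U)
    (μ : MeasureTheory.ComplexMeasure (ℂ × ℂ))
    (hμX : μ.variation (frontier U ×ˢ frontier U)ᶜ = 0)
    (hμD : μ.variation (Set.diagonal ℂ) = 0) :
    ∃ K : ℝ, 0 < K ∧ ∃ E : Set ℂ, LipCauchy.HasFullAreaDensity E b ∧
      ∀ g ∈ LipCauchy.algebraTilde α U, g b = 0 →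
        LipCauchy.Represents
          (LipCauchy.cauchyValue (LipCauchy.moduleAct g (LipCauchy.lipFunctional α μ)))
          (LipCauchy.distCauchy (LipCauchy.moduleAct g (LipCauchy.lipFunctional α μ))) ∧
        ∀ a ∈ E, LipCauchy.CauchyConverges α μ g a ∧
          ‖a - b‖ *
            ‖LipCauchy.cauchyValue (LipCauchy.moduleAct g (LipCauchy.lipFunctional α μ)) a‖ ≤
            K * LipCauchy.lipNorm α g := by
  have := LipCauchy.isFiniteMeasure_variation μ
  -- In `K`, the 3 is one total mass from the constant term plus two from the atom at `b`; the 1 is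
  -- the sublevel threshold. Restricting to `{b}ᶜ` removes the atom, as the density lemma requires.
  refine ⟨5 * (3 * μ.variation.real Set.univ + 1), by positivity,
    LipCauchy.potentialSublevel (1 + α)
      ((LipCauchy.marginalSum μ.variation).restrict {b}ᶜ) b,
    LipCauchy.hasFullAreaDensity_potentialSublevel (by linarith) (by linarith) _ (by simp),
    fun g hg hgb => ⟨LipCauchy.represents_cauchyValue hα0 hα1 hg.1 μ, fun a ha =>
      ⟨LipCauchy.cauchyConverges_of_mem_potentialSublevel hα0 hα1 hg.1 hgb ha,
        LipCauchy.norm_mul_norm_cauchyValue_le hα0 hα1 hg.1 hgb ha⟩⟩⟩
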